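/- For $t \ge 0$ let $T(t)$ be the bounded operator on the complex Hilbert space $L^2[0,1]$ given by $$T(t)f(s) = e^{-t} f(e^{-t}s), \qquad s \in [0,1].$$ Let $H$ be an infinite-dimensional separable complex Hilbert space. A bounded operator $U$ on $H$ is called \emph{universal} (in the sense of Rota) if for every bounded operator $A$ on $H$ there exist $\lambda \in \mathbb{C}$, a closed subspace $M$ of $H$ invariant under $U$, and a linear homeomorphism $\Theta : H \to M$ such that $\Theta A = \lambda\, U|_M\, \Theta$. A closed invariant subspace of an operator on $H$ is \emph{non-trivial} if it is neither $\{0\}$ nor $H$; a non-trivial closed invariant subspace is \emph{minimal} if it properly contains no non-trivial closed invariant subspace of the operator. Theorem. For every $t > 0$ and every $\mu \in \mathbb{C}$ with $|\mu| < e^{-t/2}$, the operator $\mu - T(t)$ is universal on $L^2[0,1]$. Moreover, if for some $t > 0$ every minimal non-trivial closed invariant subspace of $T(t)$ is one-dimensional, then the Invariant Subspace Problem has a positive answer: every bounded linear operator on an infinite-dimensional separable complex Hilbert space has a non-trivial closed invariant subspace. -/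

import Mathlib

open MeasureTheory

universe u

noncomputable section

/-- Lebesgue measure on the unit interval `[0,1]`. -/
abbrev unitMeasure : Measure ℝ := volume.restrict (Set.Icc (0 : ℝ) 1)

/-- The complex Hilbert space `L²[0,1]`. -/
abbrev L2Unit : Type := Lp ℂ 2 unitMeasure

theorem map_dilation_le (t : ℝ) (ht : 0 ≤ t) :
    Measure.map (fun s : ℝ => Real.exp (-t) * s) unitMeasure ≤
      ENNReal.ofReal |(Real.exp (-t))⁻¹| • unitMeasure := by
  have hm : Measurable (fun s : ℝ => Real.exp (-t) * s) := measurable_const_mul _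
  refine Measure.le_iff.2 fun A hA => ?_
  rw [Measure.map_apply hm hA, Measure.smul_apply, Measure.restrict_apply (hm hA),
    Measure.restrict_apply hA, smul_eq_mul,
    ← Real.volume_preimage_mul_left (Real.exp_ne_zero (-t))]
  refine measure_mono ?_
  rintro s ⟨hs, h0, h1⟩
  have he : Real.exp (-t) ≤ 1 := Real.exp_le_one_iff.2 (by linarith)
  exact ⟨hs, mul_nonneg (Real.exp_pos _).le h0, mul_le_one₀ he h0 h1⟩

theorem quasiMeasurePreserving_dilation (t : ℝ) (ht : 0 ≤ t) :
    Measure.QuasiMeasurePreserving (fun s : ℝ => Real.exp (-t) * s) unitMeasure unitMeasure :=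
  ⟨measurable_const_mul _,
    (Measure.absolutelyContinuous_of_le (map_dilation_le t ht)).trans
      Measure.smul_absolutelyContinuous⟩

theorem eLpNorm_dilation_le (t : ℝ) (ht : 0 ≤ t) (f : L2Unit) :
    eLpNorm (fun s : ℝ => f (Real.exp (-t) * s)) 2 unitMeasure ≤
      ENNReal.ofReal |(Real.exp (-t))⁻¹| ^ (1 / (2 : ENNReal)).toReal •
        eLpNorm f 2 unitMeasure := by
  have hq := quasiMeasurePreserving_dilation t ht
  have h := eLpNorm_map_measure (p := 2)
    ((Lp.aestronglyMeasurable f).mono_ac hq.absolutelyContinuous) hq.measurable.aemeasurable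
  have h2 := eLpNorm_mono_measure (p := 2) (f : ℝ → ℂ) (map_dilation_le t ht)
  rw [h, eLpNorm_smul_measure_of_ne_top (by simp)] at h2
  exact h2

theorem memLp_dilation (t : ℝ) (ht : 0 ≤ t) (f : L2Unit) :
    MemLp (fun s : ℝ => (Real.exp (-t) : ℂ) * f (Real.exp (-t) * s)) 2 unitMeasure := by
  refine MemLp.const_mul ⟨?_, ?_⟩ _
  · exact (Lp.aestronglyMeasurable f).comp_quasiMeasurePreserving
      (quasiMeasurePreserving_dilation t ht)
  · refine (eLpNorm_dilation_le t ht f).trans_lt ?_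
    rw [smul_eq_mul]
    exact ENNReal.mul_lt_top
      (ENNReal.rpow_lt_top_of_nonneg (by positivity) ENNReal.ofReal_ne_top) (Lp.eLpNorm_lt_top f)

/-- The bounded operator `T(t)` on `L²[0,1]`, `T(t) f (s) = e^{-t} f (e^{-t} s)`, for `t ≥ 0`. -/
def koopmanT (t : ℝ) (ht : 0 ≤ t) : L2Unit →L[ℂ] L2Unit :=
  LinearMap.mkContinuousOfExistsBound
    { toFun := fun f => (memLp_dilation t ht f).toLp
        (fun s : ℝ => (Real.exp (-t) : ℂ) * f (Real.exp (-t) * s))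
      map_add' := fun f g => by
        rw [← MemLp.toLp_add]
        refine MemLp.toLp_congr _ _ ?_
        filter_upwards [(quasiMeasurePreserving_dilation t ht).ae (Lp.coeFn_add f g)] with s hs
        simp only [Pi.add_apply] at hs ⊢
        rw [hs, mul_add]
      map_smul' := fun c f => by
        rw [RingHom.id_apply, ← MemLp.toLp_const_smul]
        refine MemLp.toLp_congr _ _ ?_
        filter_upwards [(quasiMeasurePreserving_dilation t ht).ae (Lp.coeFn_smul c f)] with s hs
        simp only [Pi.smul_apply, smul_eq_mul] at hs ⊢
        rw [hs, mul_left_comm] }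
    ⟨(ENNReal.ofReal (Real.exp (-t)) *
        ENNReal.ofReal |(Real.exp (-t))⁻¹| ^ (1 / (2 : ENNReal)).toReal).toReal, fun f => by
      have hfin : ENNReal.ofReal |(Real.exp (-t))⁻¹| ^ (1 / (2 : ENNReal)).toReal ≠ ⊤ :=
        (ENNReal.rpow_lt_top_of_nonneg (by positivity) ENNReal.ofReal_ne_top).ne
      have hc : eLpNorm (fun s : ℝ => (Real.exp (-t) : ℂ) * f (Real.exp (-t) * s)) 2 unitMeasure
          = ENNReal.ofReal (Real.exp (-t)) *
            eLpNorm (fun s : ℝ => f (Real.exp (-t) * s)) 2 unitMeasure := by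
        have h := eLpNorm_const_smul (Real.exp (-t) : ℂ)
          (fun s : ℝ => f (Real.exp (-t) * s)) 2 unitMeasure
        rw [← ofReal_norm, Complex.norm_real, Real.norm_eq_abs, Real.abs_exp] at h
        exact h
      simp only [LinearMap.coe_mk, AddHom.coe_mk]
      rw [Lp.norm_toLp, Lp.norm_def, hc, ← ENNReal.toReal_mul]
      refine ENNReal.toReal_mono
        (ENNReal.mul_ne_top (ENNReal.mul_ne_top ENNReal.ofReal_ne_top hfin)
          (Lp.eLpNorm_ne_top f)) ?_
      rw [mul_assoc]
      gcongr
      exact eLpNorm_dilation_le t ht f⟩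

theorem koopmanT_coeFn (t : ℝ) (ht : 0 ≤ t) (f : L2Unit) :
    (koopmanT t ht f : ℝ → ℂ) =ᵐ[unitMeasure]
      fun s : ℝ => (Real.exp (-t) : ℂ) * f (Real.exp (-t) * s) :=
  MemLp.coeFn_toLp (memLp_dilation t ht f)

/-- The lattice `Lat U`: the closed linear subspaces of `H` that are invariant under `U`. -/
def invariantLat {H : Type u} [NormedAddCommGroup H] [InnerProductSpace ℂ H] (U : H →L[ℂ] H) :
    Set (Submodule ℂ H) :=
  {M | IsClosed (M : Set H) ∧ ∀ x ∈ M, U x ∈ M}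

/-- `M` is a non-trivial closed invariant subspace of `U`: it is neither `0` nor all of `H`. -/
def IsNontrivialInvariant {H : Type u} [NormedAddCommGroup H] [InnerProductSpace ℂ H]
    (U : H →L[ℂ] H) (M : Submodule ℂ H) : Prop :=
  M ∈ invariantLat U ∧ M ≠ ⊥ ∧ M ≠ ⊤

/-- `M` is a minimal non-trivial closed invariant subspace of `U`: it is a non-trivial closed
invariant subspace that contains no other one. -/
def IsMinimalInvariant {H : Type u} [NormedAddCommGroup H] [InnerProductSpace ℂ H]
    (U : H →L[ℂ] H) (M : Submodule ℂ H) : Prop :=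
  Minimal (IsNontrivialInvariant U) M

/-- `U` is universal in the sense of Rota: the Hilbert space `H` is separable and
infinite-dimensional, and every bounded operator on `H` is similar to a scalar multiple of the
restriction of `U` to one of its closed invariant subspaces. -/
def IsUniversal {H : Type u} [NormedAddCommGroup H] [InnerProductSpace ℂ H] [CompleteSpace H]
    (U : H →L[ℂ] H) : Prop :=
  TopologicalSpace.SeparableSpace H ∧ ¬ FiniteDimensional ℂ H ∧
    ∀ A : H →L[ℂ] H, ∃ c : ℂ, ∃ M ∈ invariantLat U, ∃ Θ : H ≃L[ℂ] M,
      ∀ x : H, (Θ (A x) : H) = c • U (Θ x : H)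

/-- The positive answer to the Invariant Subspace Problem: every bounded linear operator on an
infinite-dimensional separable complex Hilbert space has a non-trivial closed invariant
subspace. -/
def InvariantSubspaceProperty : Prop :=
  ∀ (H : Type u) [NormedAddCommGroup H] [InnerProductSpace ℂ H] [CompleteSpace H]
    [TopologicalSpace.SeparableSpace H], ¬ FiniteDimensional ℂ H →
    ∀ A : H →L[ℂ] H, ∃ M : Submodule ℂ H, IsNontrivialInvariant A M

end

/-! The operator `T(t)` is undone on the right by an expansion `E` with `‖E‖ ≤ e^{t/2}`, and its
kernel is infinite-dimensional, since it contains all functions living on `(e^{-t}, 1]`. For `|μ| <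
e^{-t/2}` the operator `1 - μE` is invertible, and `μ - T = -T(1 - μE)`, so `μ - T` inherits both
properties. By Caradus' criterion, `exists_similar_restriction_of_rightInverse`, it is universal.

For the second claim take `μ = 0`. An operator without non-trivial invariant subspaces is similar to
a multiple of `T(t)` on some invariant `M`. Then `M` is minimal but infinite-dimensional, so not
every minimal subspace is one-dimensional. -/

/-! ### Caradus' criterion for universality -/

/-- **Caradus' criterion.** A bounded operator on a Hilbert space with a bounded right inverse, whose
kernel is isomorphic to the whole space, has every bounded operator as a multiple of one of its
restrictions, up to similarity. -/
theorem exists_similar_restriction_of_rightInverse {H : Type u} [NormedAddCommGroup H]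
    [InnerProductSpace ℂ H] [CompleteSpace H] (U B : H →L[ℂ] H) (hUB : ∀ x, U (B x) = x)
    (J : H ≃L[ℂ] U.ker) (A : H →L[ℂ] H) :
    ∃ c : ℂ, ∃ M ∈ invariantLat U, ∃ Θ : H ≃L[ℂ] M, ∀ x : H, (Θ (A x) : H) = c • U (Θ x : H) := by
  obtain ⟨l, hl0, hl⟩ : ∃ l : ℝ, 0 < l ∧ l * (‖B‖ * ‖A‖) < 1 := by
    refine ⟨(‖B‖ * ‖A‖ + 1)⁻¹, by positivity, ?_⟩
    rw [inv_mul_lt_iff₀ (by positivity)]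
    linarith
  have hlC : (l : ℂ) ≠ 0 := by exact_mod_cast hl0.ne'
  -- `Φ` sends `Y` to `l • B Y A`; the choice of `l` makes it a contraction, so `X = W + l • B X A`
  -- is solvable. Applying `U` kills `W` and cancels `B`, leaving `U X = l • X A`.
  set Φ : (H →L[ℂ] H) →L[ℂ] (H →L[ℂ] H) :=
    (l : ℂ) • ContinuousLinearMap.mulLeftRight ℂ (H →L[ℂ] H) B A with hΦ
  have hΦn : ‖Φ‖ < 1 := by
    rw [hΦ, norm_smul, Complex.norm_real, Real.norm_eq_abs, abs_of_pos hl0]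
    refine lt_of_le_of_lt ?_ hl
    gcongr
    exact ContinuousLinearMap.opNorm_mulLeftRight_apply_apply_le ℂ (H →L[ℂ] H) B A
  set W : H →L[ℂ] H := U.ker.subtypeL ∘L (J : H →L[ℂ] U.ker) with hW
  set X : H →L[ℂ] H := (((Units.oneSub Φ hΦn)⁻¹ : (_)ˣ) : (H →L[ℂ] H) →L[ℂ] (H →L[ℂ] H)) W with hX
  have hXW : X - Φ X = W := by
    have h : ((Units.oneSub Φ hΦn : (_)ˣ) : (H →L[ℂ] H) →L[ℂ] (H →L[ℂ] H)) X = W := by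
      rw [hX, ← mul_apply_eq_comp, Units.mul_inv]
      rfl
    exact h
  have hXx : ∀ x, X x = J x + (l : ℂ) • B (X (A x)) := fun x => by
    have h := congrArg (fun Y : H →L[ℂ] H => Y x) hXW
    exact sub_eq_iff_eq_add.1 h
  have hUX : ∀ x, U (X x) = (l : ℂ) • X (A x) := fun x => by
    have h : U (J x) = 0 := (J x).2
    rw [hXx x, map_add, map_smul, hUB, h, zero_add]
  -- `1 - BU` maps into `ker U` because `UB = 1`, and it removes the `B`-term of `X`, leaving `J`.
  -- The resulting bounded left inverse makes `X` injective with closed range.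
  set P : H →L[ℂ] H := (J.symm : U.ker →L[ℂ] H) ∘L
    (ContinuousLinearMap.id ℂ H - B ∘L U).codRestrict U.ker (fun x => by
      simp [LinearMap.mem_ker, hUB]) with hP
  have hPX : Function.LeftInverse P X := fun x => by
    rw [hP, ContinuousLinearMap.comp_apply, ContinuousLinearEquiv.coe_coe,
      ContinuousLinearEquiv.symm_apply_eq]
    refine Subtype.ext ?_
    change X x - B (U (X x)) = J x
    rw [hUX, hXx x]
    simp
  have hinj : Function.Injective X := hPX.injective
  have hclo : IsClosed (Set.range X) := by
    have : Set.range X = {y | X (P y) = y} := by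
      ext y
      constructor
      · rintro ⟨x, rfl⟩
        exact congrArg X (hPX x)
      · exact fun h => ⟨_, h⟩
    rw [this]
    exact isClosed_eq (by fun_prop) continuous_id
  refine ⟨(l : ℂ)⁻¹, X.range, ⟨by rwa [LinearMap.coe_range], ?_⟩, X.equivRange hinj hclo, fun x => ?_⟩
  · rintro _ ⟨x, rfl⟩
    exact ⟨(l : ℂ) • A x, by simp [hUX]⟩
  · change X (A x) = (l : ℂ)⁻¹ • U (X x)
    rw [hUX, smul_smul, inv_mul_cancel₀ hlC, one_smul]

/-! ### Separable Hilbert spaces -/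

/-- An orthonormal family in a separable space is countable. -/
theorem Orthonormal.countable_of_separableSpace {H : Type*} [NormedAddCommGroup H]
    [InnerProductSpace ℂ H] [TopologicalSpace.SeparableSpace H] {ι : Type*} {v : ι → H}
    (hv : Orthonormal ℂ v) : Countable ι := by
  have hdist : ∀ i j, i ≠ j → 1 ≤ dist (v i) (v j) := fun i j hij => by
    have h := @norm_sub_sq ℂ H _ _ _ (v i) (v j)
    rw [hv.1 i, hv.1 j, hv.2 hij] at h
    simp only [map_zero] at h
    rw [dist_eq_norm]
    nlinarith [norm_nonneg (v i - v j)]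
  refine Pairwise.countable_of_isOpen_disjoint (s := fun i => Metric.ball (v i) (1 / 2))
    (fun i j hij => Metric.ball_disjoint_ball ?_) (fun i => Metric.isOpen_ball)
    (fun i => Metric.nonempty_ball.2 (by norm_num))
  linarith [hdist i j hij]

/-- An infinite-dimensional separable Hilbert space has a Hilbert basis indexed by `ℕ`. -/
theorem nonempty_hilbertBasis_nat {H : Type*} [NormedAddCommGroup H] [InnerProductSpace ℂ H]
    [CompleteSpace H] [TopologicalSpace.SeparableSpace H] (hH : ¬ FiniteDimensional ℂ H) :
    Nonempty (HilbertBasis ℕ ℂ H) := by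
  obtain ⟨w, b, -⟩ := exists_hilbertBasis ℂ H
  have hc : Countable w := b.orthonormal.countable_of_separableSpace
  have hi : Infinite w := by
    by_contra hfin
    have := not_infinite_iff_finite.1 hfin
    have := Fintype.ofFinite w
    exact hH b.toOrthonormalBasis.toBasis.finiteDimensional_of_finite
  obtain ⟨e⟩ := nonempty_equiv_of_countable (α := ℕ) (β := w)
  refine ⟨HilbertBasis.mk (v := b ∘ e) (b.orthonormal.comp e e.injective) ?_⟩
  rw [e.surjective.range_comp, b.dense_span]

/-- Two infinite-dimensional separable complex Hilbert spaces are isometrically isomorphic. -/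
theorem nonempty_linearIsometryEquiv {H K : Type*} [NormedAddCommGroup H] [InnerProductSpace ℂ H]
    [CompleteSpace H] [TopologicalSpace.SeparableSpace H] (hH : ¬ FiniteDimensional ℂ H)
    [NormedAddCommGroup K] [InnerProductSpace ℂ K]
    [CompleteSpace K] [TopologicalSpace.SeparableSpace K] (hK : ¬ FiniteDimensional ℂ K) :
    Nonempty (H ≃ₗᵢ[ℂ] K) := by
  obtain ⟨b⟩ := nonempty_hilbertBasis_nat hH
  obtain ⟨b'⟩ := nonempty_hilbertBasis_nat hK
  exact ⟨b.repr.trans b'.repr.symm⟩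

/-! ### The right inverse of `T(t)` -/

theorem map_expansion (t : ℝ) (ht : 0 ≤ t) :
    Measure.map (fun s : ℝ => Real.exp t * s) (unitMeasure.restrict (Set.Icc 0 (Real.exp (-t)))) =
      ENNReal.ofReal (Real.exp (-t)) • unitMeasure := by
  have he : Real.exp (-t) ≤ 1 := Real.exp_le_one_iff.2 (by linarith)
  have hpre : (fun s : ℝ => Real.exp t * s) ⁻¹' Set.Icc 0 1 = Set.Icc 0 (Real.exp (-t)) := by
    rw [Set.preimage_const_mul_Icc₀ _ _ (Real.exp_pos t), zero_div, Real.exp_neg, one_div]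
  rw [Measure.restrict_restrict measurableSet_Icc,
    Set.inter_eq_left.2 (Set.Icc_subset_Icc_right he), ← hpre,
    ← Measure.restrict_map (measurable_const_mul _) measurableSet_Icc,
    Real.map_volume_mul_left (Real.exp_ne_zero t), Measure.restrict_smul, ← Real.exp_neg,
    Real.abs_exp]

theorem quasiMeasurePreserving_expansion (t : ℝ) (ht : 0 ≤ t) :
    Measure.QuasiMeasurePreserving (fun s : ℝ => Real.exp t * s)
      (unitMeasure.restrict (Set.Icc 0 (Real.exp (-t)))) unitMeasure :=
  ⟨measurable_const_mul _, by
    rw [map_expansion t ht]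
    exact Measure.smul_absolutelyContinuous⟩

/-- The function `s ↦ e^t f (e^t s)` on `[0, e^{-t}]`, extended by zero. -/
noncomputable def expansion (t : ℝ) (f : ℝ → ℂ) : ℝ → ℂ :=
  (Set.Icc 0 (Real.exp (-t))).indicator fun s => (Real.exp t : ℂ) * f (Real.exp t * s)

/-- The weight contributes `e^t` and the change of variables `(e^{-t})^{1/2}`. This factor is the
source of the radius `e^{-t/2}`. -/
theorem eLpNorm_expansion (t : ℝ) (ht : 0 ≤ t) (f : L2Unit) :
    eLpNorm (expansion t f) 2 unitMeasure =
      ENNReal.ofReal (Real.exp (t / 2)) * eLpNorm f 2 unitMeasure := by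
  have hq := quasiMeasurePreserving_expansion t ht
  have h1 := eLpNorm_map_measure (p := 2)
    ((Lp.aestronglyMeasurable f).mono_ac hq.absolutelyContinuous) hq.measurable.aemeasurable
  rw [map_expansion t ht, eLpNorm_smul_measure_of_ne_top (by simp)] at h1
  have h2 := eLpNorm_const_smul (Real.exp t : ℂ) (fun s : ℝ => f (Real.exp t * s)) 2
    (unitMeasure.restrict (Set.Icc 0 (Real.exp (-t))))
  rw [← ofReal_norm, Complex.norm_real, Real.norm_eq_abs, Real.abs_exp] at h2
  rw [expansion, eLpNorm_indicator_eq_eLpNorm_restrict measurableSet_Icc]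
  refine h2.trans ?_
  change _ * eLpNorm (f ∘ fun s => Real.exp t * s) _ _ = _
  rw [← h1, smul_eq_mul, ← mul_assoc, ENNReal.ofReal_rpow_of_pos (Real.exp_pos _),
    ← Real.exp_mul, ← ENNReal.ofReal_mul (Real.exp_pos _).le, ← Real.exp_add]
  congr 3
  norm_num
  ring

theorem memLp_expansion (t : ℝ) (ht : 0 ≤ t) (f : L2Unit) :
    MemLp (expansion t f) 2 unitMeasure := by
  refine ⟨?_, ?_⟩
  · rw [expansion, aestronglyMeasurable_indicator_iff measurableSet_Icc]
    exact ((Lp.aestronglyMeasurable f).comp_quasiMeasurePreserving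
      (quasiMeasurePreserving_expansion t ht)).const_mul _
  · rw [eLpNorm_expansion t ht]
    exact ENNReal.mul_lt_top ENNReal.ofReal_lt_top (Lp.eLpNorm_lt_top f)

theorem expansion_congr (t : ℝ) (ht : 0 ≤ t) {f g : ℝ → ℂ} (h : f =ᵐ[unitMeasure] g) :
    expansion t f =ᵐ[unitMeasure] expansion t g := by
  have h' := (ae_restrict_iff' measurableSet_Icc).1 ((quasiMeasurePreserving_expansion t ht).ae h)
  filter_upwards [h'] with s hs
  by_cases hmem : s ∈ Set.Icc 0 (Real.exp (-t))
  · simp only [expansion, Set.indicator_of_mem hmem, hs hmem]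
  · simp only [expansion, Set.indicator_of_notMem hmem]

/-- A bounded right inverse of `T(t)`. -/
noncomputable def expansionL (t : ℝ) (ht : 0 ≤ t) : L2Unit →L[ℂ] L2Unit :=
  LinearMap.mkContinuous
    { toFun := fun f => (memLp_expansion t ht f).toLp (expansion t f)
      map_add' := fun f g => by
        rw [← MemLp.toLp_add]
        refine MemLp.toLp_congr _ _ ((expansion_congr t ht (Lp.coeFn_add f g)).trans (.of_eq ?_))
        rw [expansion, expansion, expansion, ← Set.indicator_add']
        exact congrArg _ (funext fun s => mul_add _ _ _)
      map_smul' := fun c f => by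
        rw [RingHom.id_apply, ← MemLp.toLp_const_smul]
        refine MemLp.toLp_congr _ _ ((expansion_congr t ht (Lp.coeFn_smul c f)).trans (.of_eq ?_))
        refine Eq.trans (congrArg (Set.indicator _) (funext fun s => ?_))
          (Set.indicator_const_smul _ c _)
        exact mul_left_comm _ _ _ }
    (Real.exp (t / 2)) fun f => by
      simp only [LinearMap.coe_mk, AddHom.coe_mk]
      rw [Lp.norm_toLp, Lp.norm_def, eLpNorm_expansion t ht, ENNReal.toReal_mul,
        ENNReal.toReal_ofReal (Real.exp_pos _).le]

theorem expansionL_coeFn (t : ℝ) (ht : 0 ≤ t) (f : L2Unit) :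
    (expansionL t ht f : ℝ → ℂ) =ᵐ[unitMeasure] expansion t f :=
  MemLp.coeFn_toLp (memLp_expansion t ht f)

theorem norm_expansionL_le (t : ℝ) (ht : 0 ≤ t) : ‖expansionL t ht‖ ≤ Real.exp (t / 2) :=
  LinearMap.mkContinuous_norm_le _ (Real.exp_pos _).le _

/-- The contraction sends `[0,1]` into `[0, e^{-t}]`, so the cut-off is never seen, and the
dilations and weights cancel. -/
theorem koopmanT_expansionL (t : ℝ) (ht : 0 ≤ t) (f : L2Unit) :
    koopmanT t ht (expansionL t ht f) = f := by
  refine Lp.ext ?_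
  filter_upwards [koopmanT_coeFn t ht (expansionL t ht f),
    (quasiMeasurePreserving_dilation t ht).ae (expansionL_coeFn t ht f),
    ae_restrict_mem measurableSet_Icc] with s h1 h2 hs
  have hmem : Real.exp (-t) * s ∈ Set.Icc 0 (Real.exp (-t)) :=
    ⟨mul_nonneg (Real.exp_pos _).le hs.1, mul_le_of_le_one_right (Real.exp_pos _).le hs.2⟩
  have hexp : Real.exp t * (Real.exp (-t) * s) = s := by
    rw [← mul_assoc, ← Real.exp_add, add_neg_cancel, Real.exp_zero, one_mul]
  rw [h1, h2, expansion, Set.indicator_of_mem hmem, hexp, ← mul_assoc, ← Complex.ofReal_mul,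
    ← Real.exp_add, neg_add_cancel, Real.exp_zero, Complex.ofReal_one, one_mul]

/-! ### The kernel of `T(t)` is infinite-dimensional -/

/-- A function supported in `(e^{-t}, 1]` lies in the kernel of `T(t)`. -/
theorem koopmanT_indicatorConstLp (t : ℝ) (ht : 0 ≤ t) {I : Set ℝ} (hI : MeasurableSet I)
    (hIt : I ⊆ Set.Ioi (Real.exp (-t))) (hμ : unitMeasure I ≠ ⊤) (c : ℂ) :
    koopmanT t ht (indicatorConstLp 2 hI hμ c) = 0 := by
  refine Lp.ext ?_
  filter_upwards [koopmanT_coeFn t ht (indicatorConstLp 2 hI hμ c),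
    (quasiMeasurePreserving_dilation t ht).ae 
      (indicatorConstLp_coeFn (p := 2) (hs := hI) (hμs := hμ) (c := c)),
    ae_restrict_mem measurableSet_Icc, Lp.coeFn_zero ℂ 2 unitMeasure] with s h1 h2 hs h0
  have hmem : Real.exp (-t) * s ∉ I := fun h =>
    absurd (hIt h) (not_lt.2 (mul_le_of_le_one_right (Real.exp_pos _).le hs.2))
  rw [h1, h2, Set.indicator_of_notMem hmem, mul_zero, h0, Pi.zero_apply]

theorem not_finiteDimensional_ker_koopmanT (t : ℝ) (ht : 0 < t) :
    ¬ FiniteDimensional ℂ (koopmanT t ht.le).ker := by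
  set a := Real.exp (-t) with ha
  have ha0 : 0 < a := Real.exp_pos _
  have ha1 : a < 1 := by rw [ha, Real.exp_lt_one_iff]; linarith
  -- `b` decreases strictly from `1` and stays above `a`, so the intervals between consecutive terms
  -- are disjoint, of positive length, and inside `(a, 1]`. Their indicators are orthogonal and
  -- nonzero.
  set b : ℕ → ℝ := fun n => a + (1 - a) / (n + 1) with hb
  have hb_anti : StrictAnti b := strictAnti_nat_of_succ_lt fun n => by
    have : (1 - a) / ((n + 1 : ℕ) + 1 : ℝ) < (1 - a) / (n + 1) := by
      apply div_lt_div_of_pos_left <;> first | linarith | positivity | (push_cast; linarith)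
    simp only [hb]
    linarith
  have hba : ∀ n, a < b n := fun n => by
    have : 0 < (1 - a) / ((n : ℝ) + 1) := div_pos (by linarith) (by positivity)
    simp only [hb]
    linarith
  have hb1 : ∀ n, b n ≤ 1 := fun n => by
    refine (hb_anti.antitone (Nat.zero_le n)).trans ?_
    simp [hb]
  set I : ℕ → Set ℝ := fun n => Set.Ioc (b (n + 1)) (b n) with hI
  have hdisj : Pairwise (Function.onFun Disjoint I) :=
    hb_anti.antitone.pairwise_disjoint_on_Ioc_succ
  have hfin : ∀ n, unitMeasure (I n) ≠ ⊤ := fun n => measure_ne_top _ _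
  have hpos : ∀ n, unitMeasure (I n) ≠ 0 := fun n => by
    have hsub : I n ⊆ Set.Icc 0 1 := fun s hs =>
      ⟨(ha0.trans ((hba _).trans hs.1)).le, hs.2.trans (hb1 n)⟩
    rw [Measure.restrict_eq_self _ hsub, Real.volume_Ioc, ne_eq, ENNReal.ofReal_eq_zero, not_le,
      sub_pos]
    exact hb_anti (Nat.lt_succ_self n)
  set v : ℕ → L2Unit := fun n => indicatorConstLp 2 measurableSet_Ioc (hfin n) (1 : ℂ) with hv
  have hker : ∀ n, v n ∈ (koopmanT t ht.le).ker := fun n =>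
    koopmanT_indicatorConstLp t ht.le measurableSet_Ioc
      (fun s hs => (hba (n + 1)).trans hs.1) (hfin n) 1
  have hlin : LinearIndependent ℂ v := by
    refine linearIndependent_of_ne_zero_of_inner_eq_zero (𝕜 := ℂ) (fun n h => ?_)
      (fun i j hij => ?_)
    · have := congrArg norm h
      rw [hv, norm_indicatorConstLp (by norm_num) (by norm_num), norm_zero, norm_one, one_mul,
        Real.rpow_eq_zero (by positivity) (by norm_num), measureReal_eq_zero_iff (hfin n)] at this
      exact hpos n this
    · change inner ℂ (indicatorConstLp 2 _ (hfin i) (1 : ℂ)) (v j) = 0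
      rw [L2.inner_indicatorConstLp_one]
      refine integral_eq_zero_of_ae ?_
      filter_upwards [ae_restrict_mem measurableSet_Ioc,
        ae_restrict_of_ae (indicatorConstLp_coeFn (hs := measurableSet_Ioc) (hμs := hfin j)
          (p := 2) (c := (1 : ℂ)))] with s hs h
      rw [h, Set.indicator_of_notMem (Set.disjoint_left.1 (hdisj hij) hs), Pi.zero_apply]
  intro hfd
  have hlin' : LinearIndependent ℂ fun n => (⟨v n, hker n⟩ : (koopmanT t ht.le).ker) :=
    LinearIndependent.of_comp (koopmanT t ht.le).ker.subtype hlin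
  exact not_finite_iff_infinite.2 inferInstance hlin'.finite

/-! ### Universality of `μ - T(t)` -/

theorem not_finiteDimensional_L2Unit : ¬ FiniteDimensional ℂ L2Unit := fun _ =>
  not_finiteDimensional_ker_koopmanT 1 one_pos inferInstance

instance secondCountableTopology_L2Unit : SecondCountableTopology L2Unit :=
  have : Fact ((2 : ENNReal) ≠ ⊤) := ⟨by norm_num⟩
  inferInstance

theorem isUniversal_sub_koopmanT (t : ℝ) (ht : 0 < t) (μ : ℂ)
    (hμ : μ ∈ Metric.ball (0 : ℂ) (Real.exp (-t / 2))) :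
    IsUniversal (μ • ContinuousLinearMap.id ℂ L2Unit - koopmanT t ht.le) := by
  set T := koopmanT t ht.le with hT
  set E := expansionL t ht.le with hE
  set U := μ • ContinuousLinearMap.id ℂ L2Unit - T with hU
  have hn : ‖μ • E‖ < 1 := by
    rw [norm_smul]
    calc ‖μ‖ * ‖E‖ ≤ ‖μ‖ * Real.exp (t / 2) := by
          gcongr
          exact norm_expansionL_le t ht.le
      _ < Real.exp (-t / 2) * Real.exp (t / 2) := by
          gcongr
          exact mem_ball_zero_iff.1 hμ
      _ = 1 := by rw [← Real.exp_add, neg_div, neg_add_cancel, Real.exp_zero]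
  set R : L2Unit →L[ℂ] L2Unit :=
    (((Units.oneSub (μ • E) hn)⁻¹ : (_)ˣ) : L2Unit →L[ℂ] L2Unit) with hR
  have hRx : ∀ x, R x - μ • E (R x) = x := fun x =>
    congrArg (fun Y : L2Unit →L[ℂ] L2Unit => Y x) (Units.oneSub (μ • E) hn).mul_inv
  have hTE : ∀ x, T (E x) = x := koopmanT_expansionL t ht.le
  -- This is `U = -T(1 - μE)` composed with `R = (1 - μE)⁻¹`.
  have hUR : ∀ x, U (R x) = -T x := fun x => by
    conv_rhs => rw [← hRx x, map_sub, map_smul, hTE, neg_sub]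
    rfl
  have hker : ¬ FiniteDimensional ℂ U.ker := fun hfd => by
    refine not_finiteDimensional_ker_koopmanT t ht ?_
    -- `R` maps `ker T` into `ker U`, so `ker T` lies in the image of `ker U` under `1 - μE`.
    refine Submodule.finiteDimensional_of_le
      (S₂ := U.ker.map (ContinuousLinearMap.id ℂ L2Unit - μ • E : L2Unit →L[ℂ] L2Unit).toLinearMap)
      fun x hx => ⟨R x, ?_, hRx x⟩
    have hx' : T x = 0 := hx
    change U (R x) = 0
    rw [hUR, hx', neg_zero]
  have : CompleteSpace U.ker := U.isClosed_ker.completeSpace_coe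
  obtain ⟨J⟩ := nonempty_linearIsometryEquiv not_finiteDimensional_L2Unit hker
  refine ⟨inferInstance, not_finiteDimensional_L2Unit, fun A => ?_⟩
  refine exists_similar_restriction_of_rightInverse U (-(R ∘L E)) (fun x => ?_)
    J.toContinuousLinearEquiv A
  change U (-(R (E x))) = x
  rw [map_neg, hUR, hTE, neg_neg]

/-! ### Minimal invariant subspaces and the Invariant Subspace Problem -/

/-- Non-trivial invariant subspaces pull back along an embedding that intertwines `A` with a
multiple of `U`. -/
theorem IsNontrivialInvariant.comap {H K : Type*} [NormedAddCommGroup H] [InnerProductSpace ℂ H]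
    [NormedAddCommGroup K] [InnerProductSpace ℂ K] {A : H →L[ℂ] H} {U : K →L[ℂ] K} {c : ℂ}
    {M N : Submodule ℂ K} (Θ : H ≃L[ℂ] M) (hΘ : ∀ x, (Θ (A x) : K) = c • U (Θ x : K))
    (hN : IsNontrivialInvariant U N) (hNM : N < M) :
    IsNontrivialInvariant A (N.comap (M.subtypeL ∘L (Θ : H →L[ℂ] M)).toLinearMap) := by
  obtain ⟨⟨hcl, hinv⟩, hbot, -⟩ := hN
  refine ⟨⟨hcl.preimage (M.subtypeL ∘L (Θ : H →L[ℂ] M)).continuous, fun x hx => ?_⟩, ?_, ?_⟩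
  · change (Θ (A x) : K) ∈ N
    rw [hΘ]
    exact N.smul_mem _ (hinv _ hx)
  · obtain ⟨y, hy, hy0⟩ := N.exists_mem_ne_zero_of_ne_bot hbot
    refine (Submodule.ne_bot_iff _).2 ⟨Θ.symm ⟨y, hNM.le hy⟩, ?_, fun h => hy0 ?_⟩
    · change (Θ (Θ.symm ⟨y, hNM.le hy⟩) : K) ∈ N
      rwa [Θ.apply_symm_apply]
    · rw [ContinuousLinearEquiv.symm_apply_eq, map_zero] at h
      exact congrArg Subtype.val h
  · intro htop
    refine hNM.not_ge fun y hy => ?_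
    have h : Θ.symm ⟨y, hy⟩ ∈ N.comap (M.subtypeL ∘L (Θ : H →L[ℂ] M)).toLinearMap :=
      htop ▸ Submodule.mem_top
    change (Θ (Θ.symm ⟨y, hy⟩) : K) ∈ N at h
    rwa [Θ.apply_symm_apply] at h

theorem isNontrivialInvariant_ker_koopmanT (t : ℝ) (ht : 0 < t) :
    IsNontrivialInvariant (koopmanT t ht.le) (koopmanT t ht.le).ker := by
  have hinf := not_finiteDimensional_ker_koopmanT t ht
  refine ⟨⟨(koopmanT t ht.le).isClosed_ker, fun x hx => ?_⟩, fun h => hinf ?_, fun h => ?_⟩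
  · have hx' : koopmanT t ht.le x = 0 := hx
    rw [hx']
    exact Submodule.zero_mem _
  · rw [h]
    infer_instance
  -- If the kernel were everything, `f = T(E f)` would vanish for every `f`.
  · refine not_finiteDimensional_L2Unit ?_
    have hz : ∀ f : L2Unit, f = 0 := fun f => by
      have hf : expansionL t ht.le f ∈ (koopmanT t ht.le).ker := h ▸ Submodule.mem_top
      exact (koopmanT_expansionL t ht.le f).symm.trans hf
    have : Subsingleton L2Unit := ⟨fun f g => (hz f).trans (hz g).symm⟩
    infer_instance

theorem invariantSubspaceProperty_of_minimal (t : ℝ) (ht : 0 < t)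
    (hmin : ∀ M : Submodule ℂ L2Unit, IsMinimalInvariant (koopmanT t ht.le) M →
      Module.finrank ℂ M = 1) : InvariantSubspaceProperty.{u} := by
  intro H _ _ _ _ hH A
  by_contra! hA
  obtain ⟨V⟩ := nonempty_linearIsometryEquiv hH not_finiteDimensional_L2Unit
  obtain ⟨-, -, huniv⟩ := isUniversal_sub_koopmanT t ht 0 (Metric.mem_ball_self (Real.exp_pos _))
  obtain ⟨c, M, ⟨hMcl, hMinv⟩, Ψ, hΨ⟩ := huniv
    (V.toContinuousLinearEquiv.toContinuousLinearMap ∘L A ∘L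
      V.symm.toContinuousLinearEquiv.toContinuousLinearMap)
  set Θ : H ≃L[ℂ] M := V.toContinuousLinearEquiv.trans Ψ
  -- The sign appears because the universal operator at `μ = 0` is `-T(t)`.
  have hΘ : ∀ x, (Θ (A x) : L2Unit) = (-c) • koopmanT t ht.le (Θ x : L2Unit) := fun x => by
    have h := hΨ (V x)
    change (Ψ (V (A x)) : L2Unit) = (-c) • koopmanT t ht.le (Ψ (V x) : L2Unit)
    simpa using h
  have hMfin : ¬ FiniteDimensional ℂ M := fun _ =>
    hH (Θ.symm.toLinearEquiv.finiteDimensional)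
  have hMinvT : ∀ x ∈ M, koopmanT t ht.le x ∈ M := fun x hx => by
    have := M.neg_mem (hMinv x hx)
    simpa using this
  have hMbot : M ≠ ⊥ := fun h => hMfin (by rw [h]; infer_instance)
  have hno : ∀ N, IsNontrivialInvariant (koopmanT t ht.le) N → ¬ N < M := fun N hN hlt =>
    hA _ (hN.comap Θ hΘ hlt)
  -- Otherwise `ker T(t)` would be a non-trivial invariant subspace strictly inside `M`.
  have hMtop : M ≠ ⊤ := fun h => by
    have hk := isNontrivialInvariant_ker_koopmanT t ht
    exact hno _ hk (h ▸ hk.2.2.lt_top)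
  have hM : IsMinimalInvariant (koopmanT t ht.le) M :=
    ⟨⟨⟨hMcl, hMinvT⟩, hMbot, hMtop⟩, fun N hN hle =>
      (hle.eq_or_lt.resolve_right (hno N hN)).ge⟩
  -- `finrank` is `0` on infinite-dimensional spaces, so the value `1` forces `M` to be
  -- finite-dimensional.
  exact hMfin (FiniteDimensional.of_finrank_pos (by rw [hmin M hM]; exact one_pos))

theorem mainTheorem3 :
    (∀ (t : ℝ) (ht : 0 < t) (μ : ℂ), μ ∈ Metric.ball (0 : ℂ) (Real.exp (-t / 2)) →
      IsUniversal (μ • ContinuousLinearMap.id ℂ L2Unit - koopmanT t ht.le)) ∧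
    ((∃ (t : ℝ) (ht : 0 < t), ∀ M : Submodule ℂ L2Unit,
        IsMinimalInvariant (koopmanT t ht.le) M → Module.finrank ℂ M = 1) →
      InvariantSubspaceProperty.{u}) :=
  ⟨isUniversal_sub_koopmanT, fun ⟨t, ht, hmin⟩ => invariantSubspaceProperty_of_minimal t ht hmin⟩
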